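/- Let $0 < p \le 2$ and let $r, s > 0$. Put $c_p := 2\,\Gamma(1+1/p)$, $f(x) = f^{(p)}(x) := \exp\bigl(-(c_p|x|)^p\bigr)$ for $x \in \mathbb{R}$, $f_t(x) := f(x/t)$ for $t > 0$, and $\|(r,s)\|_p := (r^p+s^p)^{1/p}$. Let $D_r$ be either the continuous distribution on $\mathbb{R}$ with probability density function $f_r(x)/r$, or the discrete distribution on $\mathbb{Z}$ with probability mass function $f_r(x)/\sum_{z\in\mathbb{Z}} f_r(z)$. Then both are well-defined probability distributions, $f_s$ is integrable with respect to $D_r$, and \[ \mathbb{E}_{e \leftarrow D_r}[f_s(e)] \;\ge\; \frac{s}{\|(r,s)\|_p}, \] with equality in the continuous case and strict inequality in the discrete case. -/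

import Mathlib

open MeasureTheory

noncomputable section

namespace SoftDecoding

/-- The normalizing constant `c_p = 2 Γ(1 + 1/p)`. -/
def cp (p : ℝ) : ℝ := 2 * Real.Gamma (1 + 1 / p)

/-- The function `f^{(p)}(x) = exp (-(c_p |x|)^p)`. -/
def fp (p : ℝ) (x : ℝ) : ℝ := Real.exp (-(cp p * |x|) ^ p)

/-- The scaling `f_s(x) = f(x / s)`. -/
def scaled (f : ℝ → ℝ) (s : ℝ) (x : ℝ) : ℝ := f (x / s)

/-- The `ℓ_p` (quasi)norm `(∑ i, |x i|^p)^(1/p)` on `ℝⁿ`, for real `p > 0`. -/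
def lpNorm (p : ℝ) {n : ℕ} (x : Fin n → ℝ) : ℝ := (∑ i, |x i| ^ p) ^ (1 / p)

/-- The continuous distribution on `ℝ` with density `f_r(x) / r`, where `f = f^{(p)}`. -/
def contDist (p r : ℝ) : Measure ℝ :=
  volume.withDensity fun x => ENNReal.ofReal (scaled (fp p) r x / r)

/-- The discrete distribution on `ℤ` with mass function `f_r(x) / f_r(ℤ)`, where
`f = f^{(p)}` and `f_r(ℤ) = ∑_{z ∈ ℤ} f_r(z)`. -/
def discDist (p r : ℝ) : Measure ℤ :=
  Measure.count.withDensity fun x =>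
    ENNReal.ofReal (scaled (fp p) r x / ∑' z : ℤ, scaled (fp p) r z)

/-- `E_{e ← D_r}[f_s(e)]` for the continuous distribution `D_r`. -/
def muCont (p r s : ℝ) : ℝ := ∫ e, scaled (fp p) s e ∂(contDist p r)

/-- `E_{e ← D_r}[f_s(e)]` for the discrete distribution `D_r`. -/
def muDisc (p r s : ℝ) : ℝ := ∫ e : ℤ, scaled (fp p) s (e : ℝ) ∂(discDist p r)

end SoftDecoding

end

/-!
Multiplying the two weights gives `f_r * f_s = f_t` with `t = r s / ‖(r, s)‖_p < r`, so the
expectation is `t / r` for the continuous distribution and `f_t(ℤ) / f_r(ℤ)` for the discrete one.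
It remains to see that `f_t(ℤ) / t` strictly decreases in `t`, that is, that the Riemann sums
`c * ∑ z : ℤ, F (c * z)` of `F x = exp (-|x| ^ p)` strictly increase with the mesh `c`.

For a Gaussian, Poisson summation turns the Riemann sum into a sum over the dual lattice, each term
of which increases with `c`. Monotonicity passes to mixtures of Gaussians, and `F` is one because
`p ≤ 2`: with `α = p / 2`, it is the limit of `exp (-((1 - exp (-h x²)) / h) ^ α)` as `h → 0`, and
`1 - (1 - y) ^ α` is a power series in `y` with nonnegative coefficients. Strictness is then
automatic: the Riemann sum of `F` is real analytic in `c` and not constant.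
-/

open Filter Set Topology
open scoped NNReal ContDiff

namespace SoftDecoding

section Analytic

theorem strictMonoOn_of_monotoneOn_of_analyticOnNhd {f : ℝ → ℝ} {s : Set ℝ}
    (hs : s.OrdConnected) (hmono : MonotoneOn f s) (hf : AnalyticOnNhd ℝ f s)
    (hne : ∀ y, ∃ x ∈ s, f x ≠ y) : StrictMonoOn f s := by
  intro a ha b hb hab
  refine (hmono ha hb hab.le).lt_of_ne fun hfab => ?_
  obtain ⟨m, hm⟩ := exists_between hab
  have hconst : f =ᶠ[𝓝 m] fun _ => f a := by
    filter_upwards [Ioo_mem_nhds hm.1 hm.2] with x hx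
    have hxs : x ∈ s := hs.out ha hb (Ioo_subset_Icc_self hx)
    exact le_antisymm (hfab ▸ hmono hxs hb hx.2.le) (hmono ha hxs hx.1.le)
  obtain ⟨x, hx, hfx⟩ := hne (f a)
  exact hfx (hf.eqOn_of_preconnected_of_eventuallyEq analyticOnNhd_const hs.isPreconnected
    (hs.out ha hb (Ioo_subset_Icc_self hm)) hconst hx)

theorem analyticAt_tsum_exp_neg_mul {ι : Type*} {v : ι → ℝ} (hv : ∀ i, 0 ≤ v i)
    (hsum : ∀ t > 0, Summable fun i => Real.exp (-(t * v i))) {t : ℝ} (ht : 0 < t) :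
    AnalyticAt ℝ (fun t => ∑' i, Real.exp (-(t * v i))) t := by
  let U : Set ℂ := {w | t / 2 < w.re}
  have hU : IsOpen U := isOpen_lt continuous_const Complex.continuous_re
  have hle (i : ι) (w : ℂ) (hw : w ∈ U) :
      ‖Complex.exp (-(w * v i))‖ ≤ Real.exp (-(t / 2 * v i)) := by
    rw [Complex.norm_exp, Complex.neg_re, Complex.re_mul_ofReal]
    gcongr
    exacts [hv i, le_of_lt hw]
  have hdiff : DifferentiableOn ℂ (fun w : ℂ => ∑' i, Complex.exp (-(w * v i))) U :=
    Complex.differentiableOn_tsum_of_summable_norm (hsum _ (half_pos ht))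
      (fun i => by fun_prop) hU hle
  have hcomplex : AnalyticAt ℂ (fun w : ℂ => ∑' i, Complex.exp (-(w * v i))) (t : ℂ) :=
    hdiff.analyticAt (hU.mem_nhds (half_lt_self ht))
  convert (Complex.reCLM.analyticAt _).comp
    (hcomplex.restrictScalars.comp (Complex.ofRealCLM.analyticAt t)) using 2 with x
  simp only [Function.comp_apply, Complex.reCLM_apply]
  rw [← Complex.ofReal_re (∑' i, Real.exp (-(x * v i)))]
  push_cast
  rfl

end Analytic

section RiemannSum

theorem integral_exp_neg_abs_mul_rpow {p c : ℝ} (hp : 0 < p) (hc : 0 < c) :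
    ∫ x : ℝ, Real.exp (-|c * x| ^ p) = 2 * Real.Gamma (1 + 1 / p) / c := by
  rw [Measure.integral_comp_mul_left fun x => Real.exp (-|x| ^ p),
    integral_comp_abs (f := fun x => Real.exp (-x ^ p)), integral_exp_neg_rpow hp,
    abs_of_pos (inv_pos.2 hc), smul_eq_mul, add_comm, inv_mul_eq_div]

theorem integrable_exp_neg_abs_mul_rpow {p c : ℝ} (hp : 0 < p) (hc : 0 < c) :
    Integrable fun x : ℝ => Real.exp (-|c * x| ^ p) := by
  have : 0 < Real.Gamma (1 + 1 / p) := Real.Gamma_pos_of_pos (by positivity)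
  exact .of_integral_ne_zero (by rw [integral_exp_neg_abs_mul_rpow hp hc]; positivity)

theorem summable_int_exp_neg_abs_mul_rpow {p c : ℝ} (hp : 0 < p) (hc : 0 < c) :
    Summable fun z : ℤ => Real.exp (-|c * z| ^ p) := by
  have hanti : AntitoneOn (fun x : ℝ => Real.exp (-|c * x| ^ p)) (Ici 0) := by
    intro x hx y _ hxy
    rw [mem_Ici] at hx
    dsimp only
    gcongr
  have hnat : Summable fun n : ℕ => Real.exp (-|c * n| ^ p) :=
    hanti.summable_of_integrableOn_Ioi_zero
      (integrable_exp_neg_abs_mul_rpow hp hc).integrableOn fun x _ => (Real.exp_pos _).le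
  exact .of_nat_of_neg (by simpa using hnat) (by simpa using hnat)

/-- The Riemann sum of mesh `c` of `F` over the whole line, with sample points `c * z`, `z : ℤ`. -/
noncomputable def riemannSum (F : ℝ → ℝ) (c : ℝ) : ℝ := c * ∑' z : ℤ, F (c * z)

/-- The convex cone of functions whose samples on every lattice `c * ℤ` are summable and whose
Riemann sums increase with the mesh. -/
def monotoneRiemannSums : Submodule ℝ≥0 (ℝ → ℝ) where
  carrier := {F | (∀ c > 0, Summable fun z : ℤ => F (c * z)) ∧ MonotoneOn (riemannSum F) (Ioi 0)}
  add_mem' := by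
    rintro F G ⟨hF, hF'⟩ ⟨hG, hG'⟩
    have hadd : EqOn (riemannSum F + riemannSum G) (riemannSum (F + G)) (Ioi 0) := fun c hc => by
      simp only [riemannSum, Pi.add_apply, (hF c hc).tsum_add (hG c hc), mul_add]
    exact ⟨fun c hc => (hF c hc).add (hG c hc), (hF'.add hG').congr hadd⟩
  zero_mem' := ⟨fun _ _ => summable_zero, fun x _ y _ _ => by simp [riemannSum]⟩
  smul_mem' := by
    rintro a F ⟨hF, hF'⟩
    have hsmul : riemannSum (a • F) = a • riemannSum F := by
      ext c
      simp only [riemannSum, Pi.smul_apply, NNReal.smul_def, smul_eq_mul, tsum_mul_left,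
        mul_left_comm]
    exact ⟨fun c hc => (hF c hc).const_smul a,
      hsmul ▸ fun x hx y hy hxy => smul_le_smul_of_nonneg_left (hF' hx hy hxy) a.2⟩

theorem mem_monotoneRiemannSums_of_tendsto {ι : Type*} {l : Filter ι} [l.NeBot]
    {F : ι → ℝ → ℝ} {G B : ℝ → ℝ} (hB : ∀ c > 0, Summable fun z : ℤ => B (c * z))
    (hF : ∀ᶠ i in l, F i ∈ monotoneRiemannSums) (hFB : ∀ᶠ i in l, ∀ x, ‖F i x‖ ≤ B x)
    (hlim : Tendsto F l (𝓝 G)) : G ∈ monotoneRiemannSums := by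
  have hlim' (x : ℝ) : Tendsto (fun i => F i x) l (𝓝 (G x)) := tendsto_pi_nhds.1 hlim x
  have hGB (x : ℝ) : ‖G x‖ ≤ B x := le_of_tendsto (hlim' x).norm (hFB.mono fun _ h => h x)
  have hsum (c : ℝ) (hc : 0 < c) :
      Tendsto (fun i => riemannSum (F i) c) l (𝓝 (riemannSum G c)) :=
    (tendsto_tsum_of_dominated_convergence (hB c hc) (fun z => hlim' _)
      (hFB.mono fun _ h z => h _)).const_mul c
  exact ⟨fun c hc => (hB c hc).of_norm_bounded fun z => hGB _, fun a ha b hb hab =>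
    le_of_tendsto_of_tendsto (hsum a ha) (hsum b hb) (hF.mono fun _ h => h.2 ha hb hab)⟩

end RiemannSum

section Gaussian

/-- The centered Gaussian `x ↦ exp (-l x²)`, not normalized. -/
noncomputable def gaussian (l : ℝ≥0) (x : ℝ) : ℝ := Real.exp (-(l * x ^ 2))

theorem gaussian_zero : gaussian 0 = 1 := by
  ext x
  simp [gaussian]

theorem gaussian_add (l m : ℝ≥0) : gaussian (l + m) = gaussian l * gaussian m := by
  ext x
  simp only [gaussian, Pi.mul_apply, ← Real.exp_add, NNReal.coe_add]
  ring_nf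

theorem gaussian_nonneg (l : ℝ≥0) (x : ℝ) : 0 ≤ gaussian l x := (Real.exp_pos _).le

theorem gaussian_le_one (l : ℝ≥0) (x : ℝ) : gaussian l x ≤ 1 :=
  Real.exp_le_one_iff.2 (neg_nonpos.2 (by positivity))

theorem continuous_gaussian_apply (x : ℝ) : Continuous fun l => gaussian l x := by
  unfold gaussian
  fun_prop

theorem summable_gaussian {l : ℝ≥0} (hl : 0 < l) {c : ℝ} (hc : 0 < c) :
    Summable fun z : ℤ => gaussian l (c * z) := by
  refine (summable_int_exp_neg_abs_mul_rpow two_pos (c := √l * c) (by positivity)).congr fun z => ?_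
  rw [gaussian, Real.rpow_two, sq_abs, mul_assoc, mul_pow, Real.sq_sqrt l.coe_nonneg]

theorem riemannSum_gaussian {l : ℝ≥0} (hl : 0 < l) {c : ℝ} (hc : 0 < c) :
    riemannSum (gaussian l) c = √(Real.pi / l) * ∑' z : ℤ, gaussian (1 / l) (Real.pi / c * z) := by
  have : (0 : ℝ) < l := hl
  have hpoisson := Real.tsum_exp_neg_mul_int_sq (a := l * c ^ 2 / Real.pi) (by positivity)
  have hsqrt : √(l * c ^ 2 / Real.pi) = c / √(Real.pi / l) := by
    rw [mul_comm, mul_div_assoc, Real.sqrt_mul (by positivity), Real.sqrt_sq hc.le,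
      ← inv_div Real.pi, Real.sqrt_inv, ← div_eq_mul_inv]
  have hleft (z : ℤ) :
      gaussian l (c * z) = Real.exp (-Real.pi * (l * c ^ 2 / Real.pi) * (z : ℝ) ^ 2) := by
    rw [gaussian]
    field_simp
  have hright (z : ℤ) : gaussian (1 / l) (Real.pi / c * z) =
      Real.exp (-Real.pi / (l * c ^ 2 / Real.pi) * (z : ℝ) ^ 2) := by
    rw [gaussian, NNReal.coe_div, NNReal.coe_one]
    field_simp
  simp only [riemannSum, hleft, hright, hpoisson, ← Real.sqrt_eq_rpow, hsqrt]
  field_simp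

theorem gaussian_mem_monotoneRiemannSums {l : ℝ≥0} (hl : 0 < l) :
    gaussian l ∈ monotoneRiemannSums := by
  refine ⟨fun c hc => summable_gaussian hl hc, fun a ha b hb hab => ?_⟩
  rw [mem_Ioi] at ha hb
  have hdual {c : ℝ} (hc : 0 < c) : Summable fun z : ℤ => gaussian (1 / l) (Real.pi / c * z) :=
    summable_gaussian (by positivity) (by positivity)
  rw [riemannSum_gaussian hl ha, riemannSum_gaussian hl hb]
  gcongr with z
  · exact hdual ha
  · exact hdual hb
  · simp only [gaussian, mul_pow]
    gcongr

/-- The Gaussians `x ↦ exp (-l x²)`, `l ≥ 0`, as a multiplicative monoid. -/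
def gaussians : Submonoid (ℝ → ℝ) where
  carrier := range gaussian
  one_mem' := ⟨0, gaussian_zero⟩
  mul_mem' := by
    rintro _ _ ⟨l, rfl⟩ ⟨m, rfl⟩
    exact ⟨l + m, gaussian_add l m⟩

/-- The pointwise limits of nets of nonnegative combinations of Gaussians `x ↦ exp (-l x²)`,
`l ≥ 0`. -/
def gaussianMixtures : Subalgebra ℝ≥0 (ℝ → ℝ) :=
  (Algebra.adjoin ℝ≥0 (gaussians : Set (ℝ → ℝ))).topologicalClosure

theorem isClosed_gaussianMixtures : IsClosed (gaussianMixtures : Set (ℝ → ℝ)) :=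
  Subalgebra.isClosed_topologicalClosure _

theorem gaussian_mem_gaussianMixtures (l : ℝ≥0) : gaussian l ∈ gaussianMixtures :=
  Subalgebra.le_topologicalClosure _ (Algebra.subset_adjoin ⟨l, rfl⟩)

theorem nonneg_and_le_apply_zero_of_mem_adjoin {P : ℝ → ℝ}
    (hP : P ∈ Algebra.adjoin ℝ≥0 (gaussians : Set (ℝ → ℝ))) (x : ℝ) : 0 ≤ P x ∧ P x ≤ P 0 := by
  induction hP using Algebra.adjoin_induction with
  | mem P hP =>
    obtain ⟨l, rfl⟩ := hP
    exact ⟨gaussian_nonneg l x, by simpa [gaussian] using gaussian_le_one l x⟩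
  | algebraMap a => exact ⟨a.2, le_rfl⟩
  | add P Q _ _ hP hQ => exact ⟨add_nonneg hP.1 hQ.1, add_le_add hP.2 hQ.2⟩
  | mul P Q _ _ hP hQ =>
    exact ⟨mul_nonneg hP.1 hQ.1, mul_le_mul hP.2 hQ.2 hQ.1 (hP.1.trans hP.2)⟩

theorem gaussian_mul_mem_monotoneRiemannSums_of_mem_adjoin {δ : ℝ≥0} (hδ : 0 < δ) {P : ℝ → ℝ}
    (hP : P ∈ Algebra.adjoin ℝ≥0 (gaussians : Set (ℝ → ℝ))) :
    gaussian δ * P ∈ monotoneRiemannSums := by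
  rw [← Subalgebra.mem_toSubmodule, Algebra.adjoin_eq_span, Submonoid.closure_eq] at hP
  suffices h : Submodule.span ℝ≥0 (gaussians : Set (ℝ → ℝ)) ≤
      monotoneRiemannSums.comap (LinearMap.mulLeft ℝ≥0 (gaussian δ)) from h hP
  rw [Submodule.span_le]
  rintro _ ⟨l, rfl⟩
  change gaussian δ * gaussian l ∈ monotoneRiemannSums
  exact gaussian_add δ l ▸ gaussian_mem_monotoneRiemannSums (by positivity)

theorem gaussian_mul_mem_monotoneRiemannSums {δ : ℝ≥0} (hδ : 0 < δ) {F : ℝ → ℝ}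
    (hF : F ∈ gaussianMixtures) : gaussian δ * F ∈ monotoneRiemannSums := by
  have : (𝓝[(Algebra.adjoin ℝ≥0 (gaussians : Set (ℝ → ℝ)) : Set (ℝ → ℝ))] F).NeBot :=
    mem_closure_iff_nhdsWithin_neBot.1 hF
  have hbdd : ∀ᶠ P : ℝ → ℝ in 𝓝 F, P 0 < F 0 + 1 :=
    (continuous_apply 0).continuousAt.eventually_lt_const (lt_add_one _)
  refine mem_monotoneRiemannSums_of_tendsto (F := fun P => gaussian δ * P)
    (B := fun x => gaussian δ x * (F 0 + 1)) (fun c hc => (summable_gaussian hδ hc).mul_right _)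
    (eventually_mem_nhdsWithin.mono fun P =>
      gaussian_mul_mem_monotoneRiemannSums_of_mem_adjoin hδ) ?_
    (((continuous_const_mul (gaussian δ)).tendsto F).mono_left nhdsWithin_le_nhds)
  filter_upwards [eventually_mem_nhdsWithin, nhdsWithin_le_nhds hbdd] with P hP hP0 x
  obtain ⟨hPx, hPx0⟩ := nonneg_and_le_apply_zero_of_mem_adjoin hP x
  rw [Pi.mul_apply, Real.norm_of_nonneg (mul_nonneg (gaussian_nonneg δ x) hPx)]
  exact mul_le_mul_of_nonneg_left (hPx0.trans hP0.le) (gaussian_nonneg δ x)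

theorem mem_monotoneRiemannSums_of_mem_gaussianMixtures {F : ℝ → ℝ} (hF : F ∈ gaussianMixtures)
    (hsum : ∀ c > 0, Summable fun z : ℤ => F (c * z)) : F ∈ monotoneRiemannSums := by
  have hlim : Tendsto (fun δ => gaussian δ * F) (𝓝[>] (0 : ℝ≥0)) (𝓝 F) := by
    refine tendsto_pi_nhds.2 fun x => ?_
    have h := ((continuous_gaussian_apply x).tendsto 0).mul_const (F x)
    rw [gaussian_zero, Pi.one_apply, one_mul] at h
    exact h.mono_left nhdsWithin_le_nhds
  have hmem : ∀ᶠ δ in 𝓝[>] (0 : ℝ≥0), gaussian δ * F ∈ monotoneRiemannSums := by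
    filter_upwards [self_mem_nhdsWithin] with δ hδ
    exact gaussian_mul_mem_monotoneRiemannSums hδ hF
  refine mem_monotoneRiemannSums_of_tendsto (B := fun x => ‖F x‖)
    (fun c hc => (hsum c hc).norm) hmem (.of_forall fun δ x => ?_) hlim
  rw [Pi.mul_apply, norm_mul, Real.norm_of_nonneg (gaussian_nonneg δ x)]
  exact mul_le_of_le_one_left (norm_nonneg _) (gaussian_le_one δ x)

end Gaussian

section ClosedSubalgebra

variable {X : Type*} {S : Subalgebra ℝ≥0 (X → ℝ)} {f g : X → ℝ} {α : ℝ}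

theorem mem_of_hasSum_mul_pow (hS : IsClosed (S : Set (X → ℝ))) (hf : f ∈ S) {w : ℕ → ℝ≥0}
    {e : ℕ → ℕ} (hg : ∀ x, HasSum (fun n => w n * f x ^ e n) (g x)) : g ∈ S :=
  hS.mem_of_tendsto (Pi.hasSum.2 hg : HasSum (fun n => w n • f ^ e n) g)
    (.of_forall fun _ => sum_mem fun n _ => S.smul_mem (pow_mem hf _) (w n))

theorem exp_mem (hS : IsClosed (S : Set (X → ℝ))) (hf : f ∈ S) :
    (fun x => Real.exp (f x)) ∈ S := by
  refine mem_of_hasSum_mul_pow hS hf (w := fun n => (n.factorial : ℝ≥0)⁻¹) (e := id) fun x => ?_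
  rw [Real.exp_eq_exp_ℝ]
  exact (NormedSpace.expSeries_div_hasSum_exp (f x)).congr_fun fun n => by
    simp [div_eq_inv_mul]

theorem neg_one_pow_mul_choose_succ_nonneg (h0 : 0 ≤ α) (h1 : α ≤ 1) (k : ℕ) :
    0 ≤ (-1) ^ k * Ring.choose α (k + 1) := by
  induction k with
  | zero => simpa using h0
  | succ k ih =>
    have hrec : (k + 2) * Ring.choose α (k + 2) = Ring.choose α (k + 1) * (α - (k + 1)) := by
      have h := Ring.choose_smul_choose α (k + 1).le_succ
      simp only [Nat.choose_succ_self_right, Nat.succ_eq_add_one, nsmul_eq_mul,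
        Nat.add_sub_cancel_left, Ring.choose_one_right] at h
      push_cast at h
      linear_combination h
    have hk : 0 ≤ (k : ℝ) + 1 - α := by linarith [k.cast_nonneg (α := ℝ)]
    refine nonneg_of_mul_nonneg_right (a := (k : ℝ) + 2) ?_ (by positivity)
    calc 0 ≤ (-1) ^ k * Ring.choose α (k + 1) * (k + 1 - α) := mul_nonneg ih hk
      _ = _ := by rw [mul_left_comm, hrec]; ring

theorem hasSum_one_sub_one_sub_rpow (α : ℝ) {x : ℝ} (hx : |x| < 1) :
    HasSum (fun k : ℕ => (-1) ^ k * Ring.choose α (k + 1) * x ^ (k + 1)) (1 - (1 - x) ^ α) := by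
  have h := (Real.one_add_rpow_hasFPowerSeriesOnBall_zero (a := α)).hasSum (y := -x) (by
    rw [← ENNReal.ofReal_one, Metric.eball_ofReal]
    simpa using hx)
  simp only [binomialSeries_apply, List.ofFn_const, List.prod_replicate, smul_eq_mul,
    zero_add] at h
  have htail := ((hasSum_nat_add_iff' 1).2 h).neg
  simp only [Finset.sum_range_one, Ring.choose_zero_right, pow_zero, mul_one, neg_sub,
    ← sub_eq_add_neg] at htail
  exact htail.congr_fun fun k => by rw [neg_pow x]; ring

theorem one_sub_one_sub_rpow_mem (hS : IsClosed (S : Set (X → ℝ))) (hf : f ∈ S)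
    (hf1 : ∀ x, |f x| ≤ 1) (h0 : 0 ≤ α) (h1 : α ≤ 1) :
    (fun x => 1 - (1 - f x) ^ α) ∈ S := by
  have hlt {θ : ℝ} (hθ : θ ∈ Ico 0 1) : (fun x => 1 - (1 - θ * f x) ^ α) ∈ S := by
    lift θ to ℝ≥0 using hθ.1
    refine mem_of_hasSum_mul_pow hS (S.smul_mem hf θ) (e := (· + 1))
      (w := fun k => ⟨_, neg_one_pow_mul_choose_succ_nonneg h0 h1 k⟩) fun x =>
      hasSum_one_sub_one_sub_rpow α ?_
    rw [Pi.smul_apply, NNReal.smul_def, smul_eq_mul, abs_mul, abs_of_nonneg hθ.1]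
    exact mul_lt_one_of_nonneg_of_lt_one_left hθ.1 hθ.2 (hf1 x)
  have hlim : Tendsto (fun (θ : ℝ) x => 1 - (1 - θ * f x) ^ α) (𝓝[<] 1)
      (𝓝 fun x => 1 - (1 - f x) ^ α) := by
    refine tendsto_pi_nhds.2 fun x => Tendsto.mono_left ?_ nhdsWithin_le_nhds
    have hcont : Continuous fun θ : ℝ => 1 - (1 - θ * f x) ^ α := by
      fun_prop (disch := assumption)
    simpa using hcont.tendsto 1
  exact hS.mem_of_tendsto hlim (mem_of_superset (Ico_mem_nhdsLT zero_lt_one) fun _ => hlt)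

theorem exp_neg_mul_one_sub_rpow_mem (hS : IsClosed (S : Set (X → ℝ))) (hf : f ∈ S)
    (hf1 : ∀ x, |f x| ≤ 1) (h0 : 0 ≤ α) (h1 : α ≤ 1) (c : ℝ≥0) :
    (fun x => Real.exp (-(c * (1 - f x)) ^ α)) ∈ S := by
  have hmem := S.smul_mem
    (exp_mem hS (S.smul_mem (one_sub_one_sub_rpow_mem hS hf hf1 h0 h1) (c ^ α)))
    (Real.exp (-(c : ℝ) ^ α)).toNNReal
  convert hmem using 1
  ext x
  have hx : 0 ≤ 1 - f x := sub_nonneg.2 (le_of_abs_le (hf1 x))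
  simp only [Pi.smul_apply, NNReal.smul_def, NNReal.coe_rpow, smul_eq_mul,
    Real.coe_toNNReal _ (Real.exp_pos _).le, ← Real.exp_add, Real.mul_rpow c.coe_nonneg hx]
  ring_nf

end ClosedSubalgebra

section ExpNegAbsRpow

variable {p : ℝ}

theorem tendsto_inv_mul_one_sub_exp_neg_mul (v : ℝ) :
    Tendsto (fun h : ℝ => h⁻¹ * (1 - Real.exp (-(h * v)))) (𝓝[>] 0) (𝓝 v) := by
  have hderiv : HasDerivAt (fun h : ℝ => 1 - Real.exp (-(h * v))) v 0 := by
    simpa using ((hasDerivAt_mul_const v).neg.exp (x := 0)).const_sub 1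
  simpa using hderiv.tendsto_slope_zero_right

theorem exp_neg_abs_rpow_mem_gaussianMixtures (hp0 : 0 < p) (hp2 : p ≤ 2) :
    (fun x : ℝ => Real.exp (-|x| ^ p)) ∈ gaussianMixtures := by
  have hlim : Tendsto (fun (h x : ℝ) => Real.exp (-(h⁻¹ * (1 - Real.exp (-(h * x ^ 2)))) ^ (p / 2)))
      (𝓝[>] 0) (𝓝 fun x => Real.exp (-|x| ^ p)) := by
    refine tendsto_pi_nhds.2 fun x => ?_
    have hx : (x ^ 2) ^ (p / 2) = |x| ^ p := by
      rw [← sq_abs, ← Real.rpow_natCast_mul (abs_nonneg x)]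
      congr 1
      push_cast
      ring
    rw [← hx]
    exact ((tendsto_inv_mul_one_sub_exp_neg_mul (x ^ 2)).rpow_const
      (.inr (by positivity))).neg.rexp
  refine isClosed_gaussianMixtures.mem_of_tendsto hlim ?_
  filter_upwards [self_mem_nhdsWithin] with h hh
  lift h to ℝ≥0 using le_of_lt hh
  refine exp_neg_mul_one_sub_rpow_mem isClosed_gaussianMixtures (gaussian_mem_gaussianMixtures h)
    (fun x => ?_) (by positivity) (by linarith) h⁻¹
  rw [abs_of_nonneg (gaussian_nonneg h x)]
  exact gaussian_le_one h x

theorem analyticOnNhd_riemannSum_exp_neg_abs_rpow (hp : 0 < p) :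
    AnalyticOnNhd ℝ (riemannSum fun x => Real.exp (-|x| ^ p)) (Ioi 0) := by
  intro c hc
  rw [mem_Ioi] at hc
  have hsum (t : ℝ) (ht : 0 < t) : Summable fun z : ℤ => Real.exp (-(t * |(z : ℝ)| ^ p)) := by
    refine (summable_int_exp_neg_abs_mul_rpow hp (c := t ^ p⁻¹) (by positivity)).congr fun z => ?_
    rw [abs_mul, Real.mul_rpow (abs_nonneg _) (abs_nonneg _), abs_of_pos (by positivity),
      Real.rpow_inv_rpow ht.le hp.ne']
  have hrpow : AnalyticAt ℝ (fun c : ℝ => c ^ p) c :=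
    (Real.contDiffAt_rpow_const_of_ne (n := ω) hc.ne').analyticAt
  have h : AnalyticAt ℝ (fun c : ℝ => c * ∑' z : ℤ, Real.exp (-(c ^ p * |(z : ℝ)| ^ p))) c :=
    analyticAt_id.mul <| AnalyticAt.fun_comp (f := fun c : ℝ => c ^ p)
      (analyticAt_tsum_exp_neg_mul (fun z : ℤ => by positivity) hsum (Real.rpow_pos_of_pos hc p))
      hrpow
  refine h.congr ?_
  filter_upwards [Ioi_mem_nhds hc] with c hc
  rw [mem_Ioi] at hc
  simp only [riemannSum, abs_mul, abs_of_pos hc, Real.mul_rpow hc.le (abs_nonneg _)]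

theorem strictMonoOn_riemannSum_exp_neg_abs_rpow (hp0 : 0 < p) (hp2 : p ≤ 2) :
    StrictMonoOn (riemannSum fun x => Real.exp (-|x| ^ p)) (Ioi 0) := by
  have hsum (c : ℝ) (hc : 0 < c) : Summable fun z : ℤ => Real.exp (-|c * z| ^ p) :=
    summable_int_exp_neg_abs_mul_rpow hp0 hc
  refine strictMonoOn_of_monotoneOn_of_analyticOnNhd ordConnected_Ioi
    (mem_monotoneRiemannSums_of_mem_gaussianMixtures
      (exp_neg_abs_rpow_mem_gaussianMixtures hp0 hp2) hsum).2
    (analyticOnNhd_riemannSum_exp_neg_abs_rpow hp0) fun y => ?_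
  have hc : 0 < |y| + 1 := by positivity
  refine ⟨|y| + 1, hc, ne_of_gt ?_⟩
  have hone : 1 ≤ ∑' z : ℤ, Real.exp (-|(|y| + 1) * z| ^ p) := by
    simpa [Real.zero_rpow hp0.ne'] using
      (hsum _ hc).le_tsum 0 fun z _ => (Real.exp_pos _).le
  calc y < |y| + 1 := (le_abs_self y).trans_lt (lt_add_one _)
    _ ≤ _ := le_mul_of_one_le_right hc.le hone

end ExpNegAbsRpow

section Distributions

variable {p r s t : ℝ}

theorem cp_pos (hp : 0 < p) : 0 < cp p :=
  mul_pos two_pos (Real.Gamma_pos_of_pos (by positivity))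

theorem scaled_fp_eq (hp : 0 < p) (ht : 0 < t) (x : ℝ) :
    scaled (fp p) t x = Real.exp (-|cp p / t * x| ^ p) := by
  rw [scaled, fp, abs_mul, abs_div, abs_div, abs_of_pos ht, abs_of_pos (cp_pos hp),
    mul_div_left_comm, mul_comm |x|]

theorem integral_scaled_fp (hp : 0 < p) (ht : 0 < t) : ∫ x, scaled (fp p) t x = t := by
  have hc := cp_pos hp
  simp only [scaled_fp_eq hp ht]
  rw [integral_exp_neg_abs_mul_rpow hp (by positivity), ← cp, div_div_cancel₀ hc.ne']

theorem summable_scaled_fp (hp : 0 < p) (ht : 0 < t) :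
    Summable fun z : ℤ => scaled (fp p) t z := by
  simp only [scaled_fp_eq hp ht]
  exact summable_int_exp_neg_abs_mul_rpow hp (div_pos (cp_pos hp) ht)

theorem integrable_scaled_fp_comp {X : Type*} [MeasurableSpace X] {μ : Measure X}
    [IsFiniteMeasure μ] (hp : 0 < p) (t : ℝ) {g : X → ℝ} (hg : Measurable g) :
    Integrable (fun x => scaled (fp p) t (g x)) μ := by
  have hc := cp_pos hp
  have hmeas : Measurable fun x => scaled (fp p) t (g x) := by
    unfold scaled fp
    fun_prop
  refine .of_bound hmeas.aestronglyMeasurable 1 (.of_forall fun x => ?_)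
  rw [scaled, fp, Real.norm_of_nonneg (Real.exp_pos _).le, Real.exp_le_one_iff, neg_nonpos]
  positivity

theorem strictAntiOn_tsum_scaled_fp_div (hp0 : 0 < p) (hp2 : p ≤ 2) :
    StrictAntiOn (fun t => (∑' z : ℤ, scaled (fp p) t z) / t) (Ioi 0) := by
  intro a ha b hb hab
  rw [mem_Ioi] at ha hb
  have hc := cp_pos hp0
  have hriemann {t : ℝ} (ht : 0 < t) : (∑' z : ℤ, scaled (fp p) t z) / t =
      riemannSum (fun x => Real.exp (-|x| ^ p)) (cp p / t) / cp p := by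
    simp only [riemannSum, scaled_fp_eq hp0 ht]
    field_simp
  dsimp only
  rw [hriemann ha, hriemann hb]
  refine div_lt_div_of_pos_right (strictMonoOn_riemannSum_exp_neg_abs_rpow hp0 hp2 ?_ ?_ ?_) hc
  · exact div_pos hc hb
  · exact div_pos hc ha
  · exact div_lt_div_of_pos_left hc ha hab

theorem lpNorm_pair (p : ℝ) (hr : 0 < r) (hs : 0 < s) :
    lpNorm p ![r, s] = (r ^ p + s ^ p) ^ (1 / p) := by
  simp [lpNorm, abs_of_pos hr, abs_of_pos hs]

theorem lt_lpNorm_pair (hp : 0 < p) (hr : 0 < r) (hs : 0 < s) : s < lpNorm p ![r, s] := by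
  rw [lpNorm_pair p hr hs, one_div, Real.lt_rpow_inv_iff_of_pos hs.le (by positivity) hp]
  exact lt_add_of_pos_left _ (by positivity)

theorem lpNorm_pair_pos (p : ℝ) (hr : 0 < r) (hs : 0 < s) : 0 < lpNorm p ![r, s] := by
  rw [lpNorm_pair p hr hs]
  positivity

theorem scaled_fp_mul_scaled_fp (hp : 0 < p) (hr : 0 < r) (hs : 0 < s) (x : ℝ) :
    scaled (fp p) r x * scaled (fp p) s x = scaled (fp p) (r * s / lpNorm p ![r, s]) x := by
  have hc := cp_pos hp
  have hN := lpNorm_pair_pos p hr hs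
  have hNp : lpNorm p ![r, s] ^ p = r ^ p + s ^ p := by
    rw [lpNorm_pair p hr hs, one_div, Real.rpow_inv_rpow (by positivity) hp.ne']
  have := Real.rpow_pos_of_pos hr p
  have := Real.rpow_pos_of_pos hs p
  simp only [scaled, fp, ← Real.exp_add, abs_div, abs_of_pos hr, abs_of_pos hs, abs_mul,
    abs_of_pos hN]
  congr 1
  simp (disch := positivity) only [Real.mul_rpow, Real.div_rpow, hNp]
  field_simp
  ring

theorem contDist_eq_tilted (hp : 0 < p) (hr : 0 < r) :
    contDist p r = volume.tilted fun x => -(cp p * |x / r|) ^ p := by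
  change volume.withDensity (fun x => ENNReal.ofReal (scaled (fp p) r x / r)) =
    volume.withDensity fun x => ENNReal.ofReal (scaled (fp p) r x / ∫ y, scaled (fp p) r y)
  rw [integral_scaled_fp hp hr]

theorem isProbabilityMeasure_contDist (hp : 0 < p) (hr : 0 < r) :
    IsProbabilityMeasure (contDist p r) := by
  rw [contDist_eq_tilted hp hr]
  refine isProbabilityMeasure_tilted (.of_integral_ne_zero ?_)
  exact (integral_scaled_fp hp hr).trans_ne hr.ne'

theorem muCont_eq (hp : 0 < p) (hr : 0 < r) (hs : 0 < s) :
    muCont p r s = s / lpNorm p ![r, s] := by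
  have hN := lpNorm_pair_pos p hr hs
  calc muCont p r s
      = (∫ x, scaled (fp p) r x * scaled (fp p) s x) / ∫ x, scaled (fp p) r x := by
        simp only [muCont, contDist_eq_tilted hp hr, scaled, fp, integral_exp_tilted,
          Pi.add_apply, Real.exp_add]
    _ = r * s / lpNorm p ![r, s] / r := by
        simp only [scaled_fp_mul_scaled_fp hp hr hs]
        rw [integral_scaled_fp hp (by positivity), integral_scaled_fp hp hr]
    _ = s / lpNorm p ![r, s] := by field_simp

theorem integral_count_eq_tsum {X : Type*} [Countable X] [MeasurableSpace X]
    [MeasurableSingletonClass X] {f : X → ℝ} (hf : Summable f) :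
    ∫ x, f x ∂Measure.count = ∑' x, f x := by
  rw [integral_countable (integrable_count_iff.2 hf.norm)]
  simp [Measure.real]

theorem discDist_eq_tilted (hp : 0 < p) (hr : 0 < r) :
    discDist p r = Measure.count.tilted fun z : ℤ => -(cp p * |z / r|) ^ p := by
  change Measure.count.withDensity (fun z : ℤ =>
      ENNReal.ofReal (scaled (fp p) r z / ∑' y : ℤ, scaled (fp p) r y)) =
    Measure.count.withDensity fun z : ℤ =>
      ENNReal.ofReal (scaled (fp p) r z / ∫ y : ℤ, scaled (fp p) r y ∂Measure.count)
  rw [integral_count_eq_tsum (summable_scaled_fp hp hr)]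

theorem isProbabilityMeasure_discDist (hp : 0 < p) (hr : 0 < r) :
    IsProbabilityMeasure (discDist p r) := by
  rw [discDist_eq_tilted hp hr]
  exact isProbabilityMeasure_tilted (integrable_count_iff.2 (summable_scaled_fp hp hr).norm)

theorem muDisc_eq (hp : 0 < p) (hr : 0 < r) (hs : 0 < s) :
    muDisc p r s = (∑' z : ℤ, scaled (fp p) (r * s / lpNorm p ![r, s]) z) /
      ∑' z : ℤ, scaled (fp p) r z := by
  have hN := lpNorm_pair_pos p hr hs
  calc muDisc p r s
      = (∫ z : ℤ, scaled (fp p) r z * scaled (fp p) s z ∂Measure.count) /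
          ∫ z : ℤ, scaled (fp p) r z ∂Measure.count := by
        simp only [muDisc, discDist_eq_tilted hp hr, scaled, fp, integral_exp_tilted,
          Pi.add_apply, Real.exp_add]
    _ = _ := by
        simp only [scaled_fp_mul_scaled_fp hp hr hs]
        rw [integral_count_eq_tsum (summable_scaled_fp hp (by positivity)),
          integral_count_eq_tsum (summable_scaled_fp hp hr)]

theorem lt_muDisc (hp0 : 0 < p) (hp2 : p ≤ 2) (hr : 0 < r) (hs : 0 < s) :
    s / lpNorm p ![r, s] < muDisc p r s := by
  have hN := lpNorm_pair_pos p hr hs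
  have hS : 0 < ∑' z : ℤ, scaled (fp p) r z :=
    (summable_scaled_fp hp0 hr).tsum_pos (fun z => (Real.exp_pos _).le) 0 (Real.exp_pos _)
  have ht : 0 < r * s / lpNorm p ![r, s] := by positivity
  have htr : r * s / lpNorm p ![r, s] < r := by
    rw [div_lt_iff₀ hN]
    exact mul_lt_mul_of_pos_left (lt_lpNorm_pair hp0 hr hs) hr
  have hlt := strictAntiOn_tsum_scaled_fp_div hp0 hp2 ht hr htr
  calc s / lpNorm p ![r, s]
      = r * s / lpNorm p ![r, s] / r := by field_simp
    _ < (∑' z : ℤ, scaled (fp p) (r * s / lpNorm p ![r, s]) z) / ∑' z : ℤ, scaled (fp p) r z := by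
        rwa [div_lt_div_iff₀ hr hS, mul_comm (_ / _), ← div_lt_div_iff₀ hr ht]
    _ = muDisc p r s := (muDisc_eq hp0 hr hs).symm

end Distributions

end SoftDecoding

theorem lemma4p4 (p r s : ℝ) (hp0 : 0 < p) (hp2 : p ≤ 2) (hr : 0 < r) (hs : 0 < s) :
    (IsProbabilityMeasure (SoftDecoding.contDist p r) ∧
      Integrable (fun e : ℝ => SoftDecoding.scaled (SoftDecoding.fp p) s e)
        (SoftDecoding.contDist p r) ∧
      SoftDecoding.muCont p r s = s / SoftDecoding.lpNorm p ![r, s]) ∧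
    (IsProbabilityMeasure (SoftDecoding.discDist p r) ∧
      Integrable (fun e : ℤ => SoftDecoding.scaled (SoftDecoding.fp p) s (e : ℝ))
        (SoftDecoding.discDist p r) ∧
      SoftDecoding.muDisc p r s > s / SoftDecoding.lpNorm p ![r, s]) := by
  have hcont := SoftDecoding.isProbabilityMeasure_contDist hp0 hr
  have hdisc := SoftDecoding.isProbabilityMeasure_discDist hp0 hr
  exact ⟨⟨hcont, SoftDecoding.integrable_scaled_fp_comp hp0 s measurable_id,
      SoftDecoding.muCont_eq hp0 hr hs⟩,
    hdisc, SoftDecoding.integrable_scaled_fp_comp hp0 s (measurable_of_countable _),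
      SoftDecoding.lt_muDisc hp0 hp2 hr hs⟩
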